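/- All graphs are finite and simple. A graph $G$ with $n\ge 1$ vertices is *recursively partitionable* (RP) if $G\simeq K_1$, or if $G$ is connected and, for every integer partition $a_1\le a_2\le\dots\le a_k$ of $n$ into $k\ge 2$ positive parts, there is a partition $\{A_1,\dots,A_k\}$ of $V(G)$ such that, for each $i$, $|A_i|=a_i$ and the induced subgraph $G[A_i]$ is RP. A set $S\subseteq V(G)$ is a *vertex cut* of $G$ if $G-S$ is disconnected, and $c(G-S)$ denotes the number of connected components of $G-S$. **Theorem.** Let $S$ be a vertex cut of a graph $G$ with $|S|\ge 2$. If $c(G-S)\ge 3|S|$, then $G$ is not RP. (Equivalently, if $G$ is RP and $S$ is a vertex cut of $G$ with $|S|\ge 2$, then $c(G-S)\le 3|S|-1$.) -/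

import Mathlib

universe u

namespace SimpleGraph

/-- A finite graph `G` of order `n` is recursively partitionable (RP) if `G ≃ K₁`, or `G` is
connected and for every integer partition `a₁ ≤ ⋯ ≤ aₖ` of `n` there is a partition
`{A₁, …, Aₖ}` of the vertex set with `|Aᵢ| = aᵢ` such that each induced subgraph `G[Aᵢ]` is RP.
The one-part partition `(n)`, for which the requirement would only say "`G` is RP" again, is left
out (`2 ≤ k`), so the recursion is on the order of the graph. -/
def IsRP {V : Type u} [Finite V] (G : SimpleGraph V) : Prop :=
  Nat.card V = 1 ∨
    (G.Connected ∧
      ∀ (k : ℕ) (a : Fin k → ℕ) (_ : 2 ≤ k) (_ : Monotone a) (_ : ∀ i, 0 < a i)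
        (_ : ∑ i, a i = Nat.card V),
        ∃ (A : Fin k → Set V) (_ : ∀ i, (A i).ncard = a i),
          (∀ v, ∃! i, v ∈ A i) ∧ ∀ i, IsRP (G.induce (A i)))
termination_by Nat.card V
decreasing_by
  rename_i hk _ hpos hsum hA
  rw [Nat.card_coe_set_eq, hA i, ← hsum]
  have : Nontrivial (Fin k) := Fin.nontrivial_iff_two_le.mpr hk
  obtain ⟨j, hj⟩ := exists_ne i
  exact Finset.single_lt_sum hj (Finset.mem_univ i) (Finset.mem_univ j) (hpos j)
    (fun _ _ _ => Nat.zero_le _)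

/-- The defining equation of `SimpleGraph.IsRP`. -/
theorem isRP_iff {V : Type u} [Finite V] (G : SimpleGraph V) :
    G.IsRP ↔ Nat.card V = 1 ∨
      (G.Connected ∧
        ∀ (k : ℕ) (a : Fin k → ℕ), 2 ≤ k → Monotone a → (∀ i, 0 < a i) →
          ∑ i, a i = Nat.card V →
          ∃ A : Fin k → Set V, (∀ i, (A i).ncard = a i) ∧
            (∀ v, ∃! i, v ∈ A i) ∧ ∀ i, (G.induce (A i)).IsRP) := by
  rw [IsRP]
  simp only [exists_prop]

/-- `S` is a vertex cut of `G`: the graph `G - S` is disconnected, i.e. it has two vertices with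
no path between them. -/
def IsVertexCut {V : Type u} (G : SimpleGraph V) (S : Set V) : Prop :=
  ¬ (G.induce Sᶜ).Preconnected

/-- `c(G)`, the number of connected components of `G`. -/
noncomputable def numComponents {V : Type u} (G : SimpleGraph V) : ℕ :=
  Nat.card G.ConnectedComponent

end SimpleGraph

/-!
Colour the vertices of `G - S` by their component. A recursively partitionable set `U` missing `S`
is connected, hence has one colour. We bound the number of colours of `U` by induction on `#U`: it
is at most three if `#(U ∩ S) = 1` and less than `3 * #(U ∩ S)` if `#(U ∩ S) ≥ 2`.

In a minimal counterexample split `U` into parts whose orders are not sizes of colour classes. A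
part missing `S` would not use up a colour, so the other part would be a smaller counterexample.
Hence both parts meet `S`, and adding up their bounds leaves one possibility: each part has one
vertex of `S` and three colours, and these six colours are distinct. Recursively partitionable sets
of this kind have order `5` or at least `7`. Applied to splits with a part of order at most six,
this forces the class sizes `1, 2, 3, 4, 5, 6`, and then a split of the `23` vertices into `7 + 16`
fails because the larger part cannot be halved.
-/

open SimpleGraph Finset

namespace RecursivelyPartitionable

section PositiveMultisets

variable {M N : Multiset ℕ}

theorem sum_add_card_le_of_le (hM : ∀ d ∈ M, 0 < d) (hNM : N ≤ M) :
    N.sum + M.card ≤ M.sum + N.card := by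
  obtain ⟨R, rfl⟩ := Multiset.le_iff_exists_add.mp hNM
  have hR : R.card ≤ R.sum := by
    simpa using Multiset.card_nsmul_le_sum (a := 1) fun d hd =>
      hM d (Multiset.mem_add.mpr (Or.inr hd))
  simp only [Multiset.sum_add, Multiset.card_add]
  omega

theorem card_le_sum_of_pos (hM : ∀ d ∈ M, 0 < d) : M.card ≤ M.sum := by
  simpa using sum_add_card_le_of_le hM (Multiset.zero_le M)

theorem add_card_le_sum_add_one (hM : ∀ d ∈ M, 0 < d) {d : ℕ} (hd : d ∈ M) :
    d + M.card ≤ M.sum + 1 := by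
  simpa using sum_add_card_le_of_le hM (Multiset.singleton_le.mpr hd)

/-- If every pair `a + b = n` met `M`, then `M` would contain `⌊n / 2⌋` distinct elements
dominating `1, 2, …, ⌊n / 2⌋`, which makes its sum too large. -/
theorem exists_add_eq_notMem_of_sum_lt (hM : ∀ d ∈ M, 0 < d) (hcard : 4 ≤ M.card) {n : ℕ}
    (hsum : M.sum < n) : ∃ a b, 0 < a ∧ 0 < b ∧ a + b = n ∧ a ∉ M ∧ b ∉ M := by
  by_contra! hmeet
  let g (k : ℕ) : ℕ := if k + 1 ∈ M then k + 1 else n - (k + 1)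
  have hg (k : ℕ) (hk : k ∈ range (n / 2)) : g k ∈ M ∧ (g k = k + 1 ∨ g k = n - (k + 1)) := by
    rw [mem_range] at hk
    by_cases hkM : k + 1 ∈ M
    · simp [g, hkM]
    · simpa [g, hkM] using hmeet (k + 1) (n - (k + 1)) (by omega) (by omega) (by omega) hkM
  have hdom (k : ℕ) (hk : k ∈ range (n / 2)) : k + 1 ≤ g k := by
    have hgk := (hg k hk).2
    rw [mem_range] at hk
    omega
  have hnodup : ((range (n / 2)).val.map g).Nodup :=
    (nodup _).map_on fun j hj k hk hjk => by
      have hgj := (hg j hj).2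
      have hgk := (hg k hk).2
      rw [mem_val, mem_range] at hj hk
      omega
  have hle : (range (n / 2)).val.map g ≤ M :=
    (Multiset.le_iff_subset hnodup).mpr fun d hd => by
      obtain ⟨k, hk, rfl⟩ := Multiset.mem_map.mp hd
      exact (hg k hk).1
  have hlower : ∑ k ∈ range (n / 2), (k + 1) + M.card ≤ M.sum + n / 2 :=
    calc ∑ k ∈ range (n / 2), (k + 1) + M.card
        ≤ ((range (n / 2)).val.map g).sum + M.card := by gcongr; exact sum_le_sum hdom
      _ ≤ M.sum + ((range (n / 2)).val.map g).card := sum_add_card_le_of_le hM hle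
      _ = M.sum + n / 2 := by rw [Multiset.card_map, card_val, card_range]
  have hgauss := sum_range_id_mul_two (n / 2 + 1)
  rw [sum_range_succ', add_zero, Nat.add_sub_cancel] at hgauss
  have hhalf : n ≤ 2 * (n / 2) + 1 := by omega
  generalize n / 2 = m at *
  zify at *
  nlinarith [sq_nonneg (2 * (m : ℤ) - 5)]

end PositiveMultisets

section FiberSizes

variable {α ι : Type*} [DecidableEq ι] (f : α → ι)

/-- The multiset of cardinalities of the nonempty fibres of `f` on `W`. -/
def fiberSizes (W : Finset α) : Multiset ℕ :=
  (W.image f).val.map fun i => #{w ∈ W | f w = i}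

theorem card_fiberSizes (W : Finset α) : (fiberSizes f W).card = #(W.image f) :=
  Multiset.card_map _ _

theorem sum_fiberSizes (W : Finset α) : (fiberSizes f W).sum = #W :=
  (card_eq_sum_card_image f W).symm

variable {f}

theorem mem_fiberSizes {W : Finset α} {d : ℕ} :
    d ∈ fiberSizes f W ↔ ∃ w ∈ W, #{x ∈ W | f x = f w} = d := by
  simp [fiberSizes]

theorem pos_of_mem_fiberSizes {W : Finset α} {d : ℕ} (hd : d ∈ fiberSizes f W) : 0 < d := by
  obtain ⟨w, hw, rfl⟩ := mem_fiberSizes.mp hd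
  exact card_pos.mpr ⟨w, mem_filter.mpr ⟨hw, rfl⟩⟩

theorem exists_le_mem_fiberSizes {B W : Finset α} (hBW : B ⊆ W) {d : ℕ}
    (hd : d ∈ fiberSizes f B) : ∃ e ∈ fiberSizes f W, d ≤ e := by
  obtain ⟨w, hw, rfl⟩ := mem_fiberSizes.mp hd
  exact ⟨_, mem_fiberSizes.mpr ⟨w, hBW hw, rfl⟩, card_le_card (filter_subset_filter _ hBW)⟩

variable [DecidableEq α]

theorem fiberSizes_union {W X : Finset α} (h : Disjoint (W.image f) (X.image f)) :
    fiberSizes f (W ∪ X) = fiberSizes f W + fiberSizes f X := by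
  have hne {w x : α} (hw : w ∈ W) (hx : x ∈ X) : f w ≠ f x :=
    disjoint_iff_ne.mp h _ (mem_image_of_mem f hw) _ (mem_image_of_mem f hx)
  rw [fiberSizes, image_union, ← disjUnion_eq_union _ _ h, disjUnion_val, Multiset.map_add]
  congr 1 <;> refine Multiset.map_congr rfl fun i hi => ?_ <;>
    obtain ⟨w, hw, rfl⟩ := mem_image.mp hi <;> rw [filter_union]
  · rw [filter_false_of_mem fun x hx => (hne hw hx).symm, union_empty]
  · rw [filter_false_of_mem fun x hx => hne hx hw, empty_union]

/-- A piece on which `f` is constant exhausts a fibre only if its size is the size of a fibre. -/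
theorem image_eq_image_union_of_card_notMem {W X : Finset α}
    (hconst : ∀ x ∈ X, ∀ y ∈ X, f x = f y) (hcard : #X ∉ fiberSizes f (W ∪ X)) :
    W.image f = (W ∪ X).image f := by
  rw [image_union, eq_comm, union_eq_left]
  intro i hi
  obtain ⟨x, hx, rfl⟩ := mem_image.mp hi
  by_contra hxW
  refine hcard (mem_fiberSizes.mpr ⟨x, mem_union_right _ hx, ?_⟩)
  rw [filter_union, filter_true_of_mem fun y hy => hconst y hy x hx,
    filter_false_of_mem fun w hw hwx => hxW (mem_image.mpr ⟨w, hw, hwx⟩), empty_union]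

end FiberSizes

section RecursivelyPartitionableSets

theorem connected_of_isRP {V : Type*} [Finite V] {G : SimpleGraph V} (h : G.IsRP) :
    G.Connected := by
  rcases (isRP_iff G).mp h with hcard | ⟨hconn, -⟩
  · obtain ⟨_, _⟩ := Nat.card_eq_one_iff_unique.mp hcard
    exact Connected.of_subsingleton
  · exact hconn

theorem isRP_of_iso {V W : Type*} [Finite V] [Finite W] {G : SimpleGraph V} {H : SimpleGraph W}
    (e : G ≃g H) (h : G.IsRP) : H.IsRP := by
  induction V, ‹Finite V›, G using IsRP.induct generalizing W with
  | _ V _ G ih =>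
    have hcard : Nat.card V = Nat.card W := Nat.card_congr e.toEquiv
    rw [isRP_iff] at h ⊢
    refine h.imp hcard.symm.trans fun ⟨hconn, hparts⟩ =>
      ⟨e.connected_iff.mp hconn, fun k a hk hmono hpos hsum => ?_⟩
    obtain ⟨A, hA, hcover, hrp⟩ := hparts k a hk hmono hpos (hsum.trans hcard.symm)
    refine ⟨fun i => e '' A i, fun i => ?_, fun w => ?_, fun i => ?_⟩
    · rw [Set.ncard_image_of_injective _ e.injective, hA]
    · have hmem (i : Fin k) : w ∈ e '' A i ↔ e.symm w ∈ A i :=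
        Set.mem_image_iff_of_inverse e.left_inv e.right_inv
      simpa only [hmem] using hcover (e.symm w)
    · exact ih k a hk hpos (hsum.trans hcard.symm) A hA i
        (e.induce e.injective.injOn.bijOn_image) (hrp i)

theorem exists_isRP_induce_compl_of_le {V : Type*} [Finite V] {G : SimpleGraph V} (h : G.IsRP)
    {a b : ℕ} (ha : 0 < a) (hab : a ≤ b) (hV : a + b = Nat.card V) :
    ∃ A : Set V, A.ncard = a ∧ (G.induce A).IsRP ∧ (G.induce Aᶜ).IsRP := by
  rcases (isRP_iff G).mp h with hone | ⟨-, hparts⟩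
  · omega
  obtain ⟨A, hA, hcover, hrp⟩ := hparts 2 ![a, b] le_rfl
    (by simpa [Fin.monotone_iff_le_succ] using hab)
    (by simpa [Fin.forall_fin_two] using ⟨ha, ha.trans_le hab⟩) (by simpa using hV)
  have hcompl : (A 0)ᶜ = A 1 := by
    ext v
    obtain ⟨i, hi, huniq⟩ := hcover v
    fin_cases i
    · exact iff_of_false (fun h0 => h0 hi) fun h1 => absurd (huniq 1 h1) (by decide)
    · exact iff_of_true (fun h0 => absurd (huniq 0 h0) (by decide)) hi
  exact ⟨A 0, hA 0, hrp 0, hcompl ▸ hrp 1⟩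

variable {V : Type*} {G : SimpleGraph V} {U A B : Finset V}

/-- `U` induces a recursively partitionable subgraph of `G`. -/
def IsRPOn (G : SimpleGraph V) (U : Finset V) : Prop :=
  (G.induce (U : Set V)).IsRP

theorem IsRPOn.of_embedding {W : Type*} [Finite W] {H : SimpleGraph W} (φ : H ↪g G)
    (hφ : Set.range φ = U) (h : H.IsRP) : IsRPOn G U := by
  have e := φ.isoInduceRange
  rw [hφ] at e
  exact isRP_of_iso e h

theorem IsRPOn.of_induce_induce {C : Set (U : Set V)} (hA : A = Subtype.val '' C)
    (h : ((G.induce (U : Set V)).induce C).IsRP) : IsRPOn G A := by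
  refine .of_embedding ((Embedding.induce (U : Set V)).comp (Embedding.induce C)) ?_ h
  rw [Embedding.coe_comp, Set.range_comp, hA]
  exact congrArg _ Subtype.range_coe

theorem IsRPOn.eq_of_adj_imp_eq {ι : Type*} {f : V → ι} (h : IsRPOn G U)
    (hf : ∀ u ∈ U, ∀ v ∈ U, G.Adj u v → f u = f v) : ∀ u ∈ U, ∀ v ∈ U, f u = f v := by
  intro u hu v hv
  obtain ⟨walk⟩ := (connected_of_isRP h).preconnected ⟨u, hu⟩ ⟨v, hv⟩
  suffices ∀ x y : (U : Set V), (G.induce (U : Set V)).Walk x y → f x = f y from this _ _ walk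
  intro x y walk
  induction walk with
  | nil => rfl
  | cons hadj _ ih => exact (hf _ (Subtype.prop _) _ (Subtype.prop _) hadj).trans ih

variable [DecidableEq V]

/-- `A` and `B` partition `U` and both induce recursively partitionable subgraphs of `G`. -/
structure IsSplit (G : SimpleGraph V) (U A B : Finset V) : Prop where
  disjoint : Disjoint A B
  union_eq : A ∪ B = U
  left : IsRPOn G A
  right : IsRPOn G B

namespace IsSplit

theorem symm (h : IsSplit G U A B) : IsSplit G U B A :=
  ⟨h.disjoint.symm, union_comm A B ▸ h.union_eq, h.right, h.left⟩

theorem right_subset (h : IsSplit G U A B) : B ⊆ U :=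
  h.union_eq ▸ subset_union_right

theorem card_inter_eq (h : IsSplit G U A B) (S : Finset V) : #(U ∩ S) = #(A ∩ S) + #(B ∩ S) := by
  rw [← h.union_eq, union_inter_distrib_right, card_union_of_disjoint]
  exact h.disjoint.mono inter_subset_left inter_subset_left

theorem sdiff_eq (h : IsSplit G U A B) (S : Finset V) : U \ S = A \ S ∪ B \ S := by
  rw [← h.union_eq, union_sdiff_distrib]

end IsSplit

theorem IsRPOn.exists_isSplit (h : IsRPOn G U) {a b : ℕ} (ha : 0 < a) (hb : 0 < b)
    (hU : #U = a + b) : ∃ A B, IsSplit G U A B ∧ #A = a ∧ #B = b := by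
  wlog hab : a ≤ b generalizing a b
  · obtain ⟨A, B, hsplit, hA, hB⟩ := this hb ha (by omega) (by omega)
    exact ⟨B, A, hsplit.symm, hB, hA⟩
  obtain ⟨C, hC, hrpC, hrpCompl⟩ := exists_isRP_induce_compl_of_le h ha hab (by simp [hU])
  classical
  let A : Finset V := C.toFinset.map (.subtype _)
  have hAU : A ⊆ U := fun v hv => by
    obtain ⟨u, -, rfl⟩ := mem_map.mp hv
    exact u.2
  have hA : #A = a := by rw [card_map, ← hC, Set.ncard_eq_toFinset_card']
  refine ⟨A, U \ A, ⟨disjoint_sdiff, union_sdiff_of_subset hAU, ?_, ?_⟩, hA, ?_⟩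
  · exact .of_induce_induce (by simp [A]) hrpC
  · refine .of_induce_induce ?_ hrpCompl
    simp [A, Set.image_compl_eq_range_sdiff_image, Subtype.val_injective]
  · rw [card_sdiff_of_subset hAU, hU, hA, Nat.add_sub_cancel_left]

end RecursivelyPartitionableSets

section Colours

variable {V ι : Type*} {G : SimpleGraph V} {S U A B : Finset V} {f : V → ι}

/-- `f` is a colouring that is constant along the edges of `G - S`, such as the map sending a
vertex outside `S` to its component in `G - S`. The values of `f` on `S` are irrelevant. -/
def LocallyConstantOff (G : SimpleGraph V) (S : Finset V) (f : V → ι) : Prop :=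
  ∀ ⦃u v⦄, u ∉ S → v ∉ S → G.Adj u v → f u = f v

theorem LocallyConstantOff.eq_of_isRPOn (hf : LocallyConstantOff G S f) (hB : IsRPOn G B)
    (hBS : Disjoint B S) : ∀ u ∈ B, ∀ v ∈ B, f u = f v :=
  hB.eq_of_adj_imp_eq fun _ hu _ hv =>
    hf (Finset.disjoint_left.mp hBS hu) (Finset.disjoint_left.mp hBS hv)

variable [DecidableEq V] [DecidableEq ι]

/-- The number of colours that `f` uses on `U` outside `S`. -/
def numColours (S : Finset V) (f : V → ι) (U : Finset V) : ℕ :=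
  #((U \ S).image f)

/-- The multiset of sizes of the colour classes of `f` on `U` outside `S`. -/
def colourSizes (S : Finset V) (f : V → ι) (U : Finset V) : Multiset ℕ :=
  fiberSizes f (U \ S)

theorem card_colourSizes (S : Finset V) (f : V → ι) (U : Finset V) :
    (colourSizes S f U).card = numColours S f U :=
  card_fiberSizes f (U \ S)

theorem pos_of_mem_colourSizes {d : ℕ} (hd : d ∈ colourSizes S f U) : 0 < d :=
  pos_of_mem_fiberSizes hd

theorem sum_colourSizes_add_card_inter (S : Finset V) (f : V → ι) (U : Finset V) :
    (colourSizes S f U).sum + #(U ∩ S) = #U := by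
  rw [colourSizes, sum_fiberSizes, card_sdiff_add_card_inter]

theorem numColours_add_card_inter_le (S : Finset V) (f : V → ι) (U : Finset V) :
    numColours S f U + #(U ∩ S) ≤ #U := by
  rw [← sum_colourSizes_add_card_inter S f U, ← card_colourSizes]
  gcongr
  exact card_le_sum_of_pos fun _ => pos_of_mem_colourSizes

theorem add_numColours_add_card_inter_le {d : ℕ} (hd : d ∈ colourSizes S f U) :
    d + numColours S f U + #(U ∩ S) ≤ #U + 1 := by
  have hle := add_card_le_sum_add_one (fun _ => pos_of_mem_colourSizes) hd
  have hsum := sum_colourSizes_add_card_inter S f U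
  rw [card_colourSizes] at hle
  omega

theorem IsSplit.numColours_left_eq (h : IsSplit G U A B) (hf : LocallyConstantOff G S f)
    (hBS : #(B ∩ S) = 0) (hB : #B ∉ colourSizes S f U) :
    numColours S f A = numColours S f U := by
  have hdisj : Disjoint B S := disjoint_iff_inter_eq_empty.mpr (card_eq_zero.mp hBS)
  rw [colourSizes, h.sdiff_eq S, sdiff_eq_self_of_disjoint hdisj] at hB
  rw [numColours, image_eq_image_union_of_card_notMem (hf.eq_of_isRPOn h.right hdisj) hB,
    numColours, h.sdiff_eq S, sdiff_eq_self_of_disjoint hdisj]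

theorem IsRPOn.exists_card_le_mem_colourSizes (hB : IsRPOn G B) (hf : LocallyConstantOff G S f)
    (hBS : #(B ∩ S) = 0) (hBU : B ⊆ U) : ∃ d ∈ colourSizes S f U, #B ≤ d := by
  have hdisj : Disjoint B S := disjoint_iff_inter_eq_empty.mpr (card_eq_zero.mp hBS)
  obtain ⟨⟨x, hx⟩⟩ := (connected_of_isRP hB).nonempty
  refine exists_le_mem_fiberSizes (subset_sdiff.mpr ⟨hBU, hdisj⟩) (mem_fiberSizes.mpr ⟨x, hx, ?_⟩)
  rw [filter_true_of_mem fun y hy => hf.eq_of_isRPOn hB hdisj y hy x hx]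

theorem not_isRPOn_of_colourSizes_lt_half (hf : LocallyConstantOff G S f) (hS : #(U ∩ S) = 1)
    {m : ℕ} (hU : #U = 2 * m) (hlt : ∀ d ∈ colourSizes S f U, d < m) : ¬ IsRPOn G U := by
  intro hrp
  have hpos : 0 < m := by
    have hle := numColours_add_card_inter_le S f U
    omega
  obtain ⟨A, B, hsplit, hA, hB⟩ := hrp.exists_isSplit hpos hpos (by omega)
  wlog hBS : #(B ∩ S) = 0 generalizing A B
  · exact this B A hsplit.symm hB hA (by have := hsplit.card_inter_eq S; omega)
  obtain ⟨d, hd, hle⟩ := hsplit.right.exists_card_le_mem_colourSizes hf hBS hsplit.right_subset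
  have hdm := hlt d hd
  omega

theorem IsRPOn.card_ne_four (hU : IsRPOn G U) (hf : LocallyConstantOff G S f)
    (hS : #(U ∩ S) = 1) (hcol : numColours S f U = 3) : #U ≠ 4 := fun hcard =>
  not_isRPOn_of_colourSizes_lt_half (m := 2) hf hS hcard
    (fun d hd => by have := add_numColours_add_card_inter_le hd; omega) hU

theorem IsRPOn.card_ne_six (hU : IsRPOn G U) (hf : LocallyConstantOff G S f)
    (hS : #(U ∩ S) = 1) (hcol : numColours S f U = 3) : #U ≠ 6 := by
  intro hcard
  have hle (d : ℕ) (hd : d ∈ colourSizes S f U) : d ≤ 3 := by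
    have := add_numColours_add_card_inter_le hd
    omega
  by_cases htwo : 2 ∈ colourSizes S f U
  · -- The class sizes are `1, 2, 2`, so there is no split into `3 + 3`.
    have hthree : 3 ∉ colourSizes S f U := fun hthree => by
      have hpair : ({2, 3} : Multiset ℕ) ≤ colourSizes S f U :=
        (Multiset.le_iff_subset (by decide)).mpr (by simp [htwo, hthree])
      have hsum := sum_colourSizes_add_card_inter S f U
      have hmany := sum_add_card_le_of_le (fun _ => pos_of_mem_colourSizes) hpair
      simp only [Multiset.insert_eq_cons, Multiset.sum_cons, Multiset.sum_singleton,
        Multiset.card_cons, Multiset.card_singleton, card_colourSizes] at hmany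
      omega
    exact not_isRPOn_of_colourSizes_lt_half hf hS (m := 3) hcard
      (fun d hd => lt_of_le_of_ne (hle d hd) fun h => hthree (h ▸ hd)) hU
  · obtain ⟨A, B, hsplit, hA, hB⟩ := hU.exists_isSplit (a := 4) (b := 2) (by omega) (by omega) hcard
    have hinter := hsplit.card_inter_eq S
    obtain hAS | hBS : #(A ∩ S) = 0 ∨ #(B ∩ S) = 0 := by omega
    · obtain ⟨d, hd, hAd⟩ :=
        hsplit.left.exists_card_le_mem_colourSizes hf hAS hsplit.symm.right_subset
      have := hle d hd
      omega
    · have hcolA := hsplit.numColours_left_eq hf hBS (hB ▸ htwo)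
      exact hsplit.left.card_ne_four hf (by omega) (hcolA.trans hcol) hA

end Colours

section MinimalCounterexample

variable {V ι : Type*} [DecidableEq V] [DecidableEq ι] {G : SimpleGraph V} {S U A B : Finset V}
  {f : V → ι}

/-- The bound that holds for all recursively partitionable sets: if `U` meets `S`, then it has fewer
than `3 * #(U ∩ S)` colours outside `S`, except that three colours are allowed when `U` contains
only one vertex of `S`. -/
def HasFewColours (S : Finset V) (f : V → ι) (U : Finset V) : Prop :=
  #(U ∩ S) = 0 ∨ numColours S f U < 3 * #(U ∩ S) ∨ #(U ∩ S) = 1 ∧ numColours S f U = 3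

/-- `U` is a recursively partitionable set of least size violating `HasFewColours`. -/
structure IsMinimalCounterexample (G : SimpleGraph V) (S : Finset V) (f : V → ι) (U : Finset V) :
    Prop where
  isRPOn : IsRPOn G U
  not_hasFewColours : ¬ HasFewColours S f U
  hasFewColours_of_card_lt : ∀ W, #W < #U → IsRPOn G W → HasFewColours S f W

/-- A split of a set with two vertices in `S` and six colours outside `S` that distributes both
evenly, so that every colour class lies in one of the two parts. -/
structure IsBalancedSplit (G : SimpleGraph V) (S : Finset V) (f : V → ι) (U A B : Finset V) : Prop
    extends IsSplit G U A B where
  card_left_inter : #(A ∩ S) = 1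
  card_right_inter : #(B ∩ S) = 1
  numColours_left : numColours S f A = 3
  numColours_right : numColours S f B = 3
  numColours_eq : numColours S f U = 6

theorem IsBalancedSplit.colourSizes_eq (h : IsBalancedSplit G S f U A B) :
    colourSizes S f U = colourSizes S f A + colourSizes S f B := by
  have hcol : numColours S f U = numColours S f A + numColours S f B := by
    rw [h.numColours_eq, h.numColours_left, h.numColours_right]
  rw [numColours, h.sdiff_eq S, image_union] at hcol
  rw [colourSizes, h.sdiff_eq S, fiberSizes_union (card_union_eq_card_add_card.mp hcol)]
  rfl

theorem IsBalancedSplit.card_left (h : IsBalancedSplit G S f U A B)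
    (hf : LocallyConstantOff G S f) : #A = 5 ∨ 7 ≤ #A := by
  have hfour := h.left.card_ne_four hf h.card_left_inter h.numColours_left
  have hsix := h.left.card_ne_six hf h.card_left_inter h.numColours_left
  have hle := numColours_add_card_inter_le S f A
  rw [h.card_left_inter, h.numColours_left] at hle
  omega

namespace IsMinimalCounterexample

theorem exists_isBalancedSplit (h : IsMinimalCounterexample G S f U)
    (hf : LocallyConstantOff G S f) {a b : ℕ} (ha : 0 < a) (hb : 0 < b) (hab : #U = a + b)
    (haU : a ∉ colourSizes S f U) (hbU : b ∉ colourSizes S f U) :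
    ∃ A B, IsBalancedSplit G S f U A B ∧ #A = a ∧ #B = b := by
  obtain ⟨A, B, hsplit, rfl, rfl⟩ := h.isRPOn.exists_isSplit ha hb hab
  have hfewA := h.hasFewColours_of_card_lt A (by omega) hsplit.left
  have hfewB := h.hasFewColours_of_card_lt B (by omega) hsplit.right
  have hmany := h.not_hasFewColours
  have hinter := hsplit.card_inter_eq S
  have hunion : numColours S f U ≤ numColours S f A + numColours S f B := by
    rw [numColours, hsplit.sdiff_eq S, image_union]
    exact card_union_le _ _
  have hA : #(A ∩ S) = 0 → numColours S f B = numColours S f U :=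
    fun hAS => hsplit.symm.numColours_left_eq hf hAS haU
  have hB : #(B ∩ S) = 0 → numColours S f A = numColours S f U :=
    fun hBS => hsplit.numColours_left_eq hf hBS hbU
  unfold HasFewColours at hfewA hfewB hmany
  exact ⟨A, B, ⟨hsplit, by omega, by omega, by omega, by omega, by omega⟩, rfl, rfl⟩

theorem card_inter_eq_two_and_numColours_eq_six (h : IsMinimalCounterexample G S f U)
    (hf : LocallyConstantOff G S f) : #(U ∩ S) = 2 ∧ numColours S f U = 6 := by
  have hmany := h.not_hasFewColours
  unfold HasFewColours at hmany
  have hsum := sum_colourSizes_add_card_inter S f U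
  obtain ⟨a, b, ha, hb, hab, haU, hbU⟩ := exists_add_eq_notMem_of_sum_lt (n := #U)
    (fun _ => pos_of_mem_colourSizes) (by rw [card_colourSizes]; omega)
    (by omega : (colourSizes S f U).sum < #U)
  obtain ⟨A, B, hsplit, -⟩ := h.exists_isBalancedSplit hf ha hb hab.symm haU hbU
  refine ⟨?_, hsplit.numColours_eq⟩
  rw [hsplit.card_inter_eq S, hsplit.card_left_inter, hsplit.card_right_inter]

theorem exists_isBalancedSplit_of_le_six (h : IsMinimalCounterexample G S f U)
    (hf : LocallyConstantOff G S f) {a : ℕ} (ha : 0 < a) (ha6 : a ≤ 6)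
    (haU : a ∉ colourSizes S f U) : ∃ A B, IsBalancedSplit G S f U A B ∧ #A = a := by
  obtain ⟨hinter, hcol⟩ := h.card_inter_eq_two_and_numColours_eq_six hf
  have hcard := numColours_add_card_inter_le S f U
  obtain ⟨A, B, hsplit, hA, -⟩ := h.exists_isBalancedSplit hf (b := #U - a) ha (by omega)
    (by omega) haU fun hd => by have := add_numColours_add_card_inter_le hd; omega
  exact ⟨A, B, hsplit, hA⟩

theorem mem_colourSizes (h : IsMinimalCounterexample G S f U) (hf : LocallyConstantOff G S f)
    {a : ℕ} (ha : 0 < a) (ha6 : a ≤ 6) (ha5 : a ≠ 5) : a ∈ colourSizes S f U := by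
  by_contra haU
  obtain ⟨A, B, hsplit, hA⟩ := h.exists_isBalancedSplit_of_le_six hf ha ha6 haU
  have hcard := hsplit.card_left hf
  omega

/-- Otherwise `U` splits into `A` of order five, too small to contain a class of size `3`, `4` or
`6`, and `B` of order `1 + 3 + 4 + 6 = 14`, which cannot be halved. -/
theorem five_mem_colourSizes (h : IsMinimalCounterexample G S f U)
    (hf : LocallyConstantOff G S f) : 5 ∈ colourSizes S f U := by
  by_contra hfive
  obtain ⟨A, B, hsplit, hA⟩ := h.exists_isBalancedSplit_of_le_six hf (by omega) (by omega) hfive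
  have hmemB {d : ℕ} (hd3 : 3 ≤ d) (hd6 : d ≤ 6) (hd5 : d ≠ 5) : d ∈ colourSizes S f B := by
    have hd := h.mem_colourSizes hf (by omega) hd6 hd5
    rw [hsplit.colourSizes_eq] at hd
    refine (Multiset.mem_add.mp hd).resolve_left fun hdA => ?_
    have hle := add_numColours_add_card_inter_le hdA
    rw [hsplit.card_left_inter, hsplit.numColours_left] at hle
    omega
  have hsizesB : {3, 4, 6} = colourSizes S f B := by
    refine Multiset.eq_of_le_of_card_le ((Multiset.le_iff_subset (by decide)).mpr ?_) ?_
    · simp [hmemB]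
    · simp [card_colourSizes, hsplit.numColours_right]
  have hcardB : #B = 2 * 7 := by
    rw [← sum_colourSizes_add_card_inter S f B, ← hsizesB, hsplit.card_right_inter]
    rfl
  exact not_isRPOn_of_colourSizes_lt_half hf hsplit.card_right_inter hcardB
    (by simp [← hsizesB]) hsplit.right

theorem colourSizes_eq (h : IsMinimalCounterexample G S f U) (hf : LocallyConstantOff G S f) :
    colourSizes S f U = {1, 2, 3, 4, 5, 6} := by
  symm
  refine Multiset.eq_of_le_of_card_le ((Multiset.le_iff_subset (by decide)).mpr ?_) ?_
  · simp [h.five_mem_colourSizes hf, h.mem_colourSizes hf]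
  · simp [card_colourSizes, (h.card_inter_eq_two_and_numColours_eq_six hf).2]

end IsMinimalCounterexample

/-- A minimal counterexample has order `2 + (1 + 2 + 3 + 4 + 5 + 6) = 23`, hence splits into parts
of orders `7` and `16`, the second of which cannot be halved. -/
theorem not_isMinimalCounterexample (hf : LocallyConstantOff G S f) :
    ¬ IsMinimalCounterexample G S f U := by
  intro h
  have hsizes := h.colourSizes_eq hf
  have hcard : #U = 7 + 16 := by
    rw [← sum_colourSizes_add_card_inter S f U, hsizes,
      (h.card_inter_eq_two_and_numColours_eq_six hf).1]
    rfl
  obtain ⟨A, B, hsplit, -, hB⟩ := h.exists_isBalancedSplit hf (by omega) (by omega) hcard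
    (by simp [hsizes]) (by simp [hsizes])
  refine not_isRPOn_of_colourSizes_lt_half hf hsplit.card_right_inter (m := 8) hB ?_ hsplit.right
  intro d hd
  have hdU : d ∈ colourSizes S f U := hsplit.colourSizes_eq ▸ Multiset.mem_add.mpr (Or.inr hd)
  simp only [hsizes, Multiset.insert_eq_cons, Multiset.mem_cons, Multiset.mem_singleton] at hdU
  omega

theorem IsRPOn.hasFewColours (hU : IsRPOn G U) (hf : LocallyConstantOff G S f) :
    HasFewColours S f U := by
  induction hn : #U using Nat.strong_induction_on generalizing U with
  | _ n ih =>
    subst hn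
    by_contra hmany
    exact not_isMinimalCounterexample hf ⟨hU, hmany, fun W hW hrp => ih #W hW hrp rfl⟩

end MinimalCounterexample

theorem exists_locallyConstantOff_numColours_eq {V : Type*} [Fintype V] [DecidableEq V]
    (G : SimpleGraph V) (S : Finset V) [Nonempty (G.induce (S : Set V)ᶜ).ConnectedComponent]
    [DecidableEq (G.induce (S : Set V)ᶜ).ConnectedComponent] :
    ∃ f : V → (G.induce (S : Set V)ᶜ).ConnectedComponent,
      LocallyConstantOff G S f ∧ numColours S f univ = (G.induce (S : Set V)ᶜ).numComponents := by
  let component := (G.induce (S : Set V)ᶜ).connectedComponentMk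
  let f := Function.extend Subtype.val component fun _ => Classical.arbitrary _
  have hf (v : ↥(S : Set V)ᶜ) : f v = component v := Subtype.val_injective.extend_apply _ _ v
  refine ⟨f, fun u v hu hv huv => ?_, ?_⟩
  · rw [hf ⟨u, hu⟩, hf ⟨v, hv⟩]
    exact ConnectedComponent.sound (Adj.reachable huv)
  · have hsurj (c : (G.induce (S : Set V)ᶜ).ConnectedComponent) : c ∈ (univ \ S).image f := by
      obtain ⟨v, rfl⟩ := c.exists_rep
      exact mem_image.mpr ⟨v, mem_sdiff.mpr ⟨mem_univ _, v.2⟩, hf v⟩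
    have := Fintype.ofFinite (G.induce (S : Set V)ᶜ).ConnectedComponent
    rw [numColours, eq_univ_iff_forall.mpr hsurj, card_univ, numComponents,
      Nat.card_eq_fintype_card]

end RecursivelyPartitionable

open RecursivelyPartitionable

theorem theorem7p1 {V : Type*} [Finite V] (G : SimpleGraph V) (S : Set V)
    (hcut : G.IsVertexCut S) (hS : 2 ≤ S.ncard)
    (hc : 3 * S.ncard ≤ (G.induce Sᶜ).numComponents) :
    ¬ G.IsRP := by
  classical
  intro hrp
  have := Fintype.ofFinite V
  lift S to Finset V using S.toFinite
  rw [Set.ncard_coe_finset] at hS hc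
  have : Nonempty (G.induce (S : Set V)ᶜ).ConnectedComponent :=
    not_isEmpty_iff.mp fun _ => hcut fun v => isEmptyElim ((G.induce _).connectedComponentMk v)
  obtain ⟨f, hf, hcol⟩ := exists_locallyConstantOff_numColours_eq G S
  have huniv : IsRPOn G univ := .of_embedding Embedding.refl (Set.range_id.trans coe_univ.symm) hrp
  have hfew : HasFewColours S f univ := huniv.hasFewColours hf
  rw [HasFewColours, univ_inter, hcol] at hfew
  omega
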